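/- Consider a finite game with players $i=1,\dots,n$, where player $i$ has $s_i\ge 1$ pure strategies. Let $\Delta_i=\{y\in\mathbb{R}^{s_i} : y_\alpha\ge 0,\ \sum_\alpha y_\alpha=1\}$ and $\Delta=\prod_i\Delta_i$, and let $e_{i\alpha}$ be the standard unit vectors of $\mathbb{R}^{s_i}$. Let $\varphi:\prod_i\mathbb{R}^{s_i}\to\prod_i\mathbb{R}^{s_i}$ be an incentive function, that is, for all $x\in\Delta$ and all $i$: $\varphi_{i\alpha}(x)\ge 0$ whenever $x_{i\alpha}=0$, and $\sum_\beta\varphi_{i\beta}(x)\ne -1$. Suppose that $\varphi$ is continuous on $\Delta$. Let $$T(x)_i=\frac{x_i+\sum_\alpha\varphi_{i\alpha}(x)\,e_{i\alpha}}{1+\sum_\beta\varphi_{i\beta}(x)} .$$ For $x\in\Delta$ write $\varphi_i(x)/x_i=(\varphi_{i\alpha}(x)/x_{i\alpha})_\alpha$ with the convention $0/0=0$; this vector is called well defined if $\varphi_{i\alpha}(x)=0$ whenever $x_{i\alpha}=0$. For $x\in\Delta$ and a player $i$, let $\Delta_i(x)$ be the set of $y\in\Delta_i$ with $y_\alpha=0$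 whenever $x_{i\alpha}=0$. A profile $x\in\Delta$ is an incentive equilibrium if, for every $i$, $\varphi_i(x)/x_i$ is well defined and $$x_i\cdot\frac{\varphi_i(x)}{x_i}=\max_{y\in\Delta_i(x)} y\cdot\frac{\varphi_i(x)}{x_i}.\qquad(*)$$ Then: 1. There exists an incentive equilibrium $\hat x\in\Delta$. 2. A profile $x\in\Delta$ is an incentive equilibrium if and only if $T(x)=x$. 3. For every $x\in\Delta$ and every player $i$: $\varphi_i(x)/x_i$ is well defined and $x_i\cdot\frac{\varphi_i(x)}{x_i}=\max_{y\in\Delta_i}y\cdot\frac{\varphi_i(x)}{x_i}$ if and only if $\varphi_i(x)/x_i$ is well defined, $(*)$ holds for $i$, and either $\sum_\beta\varphi_{i\beta}(x)\ge 0$ or $x_{i\alpha}\neq 0$ for all $\alpha$. -/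

import Mathlib

/-- A finite game in normal form: finitely many players, each with a nonempty finite set of
pure strategies and a real utility function on pure strategy profiles. -/
structure FiniteGame where
  /-- The number of players. -/
  n : ℕ
  /-- The number of pure strategies of each player. -/
  s : Fin n → ℕ
  /-- Every player has at least one pure strategy. -/
  s_pos : ∀ i, 0 < s i
  /-- The utility of each player on pure strategy profiles. -/
  utility : Fin n → (∀ j, Fin (s j)) → ℝ

namespace FiniteGame

/-- The ambient space `×ᵢ ℝ^{sᵢ}`. -/
abbrev Ambient (G : FiniteGame) : Type := ∀ i : Fin G.n, Fin (G.s i) → ℝ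

/-- The simplex `Δᵢ` of mixed strategies of player `i`. -/
def mixedStrategies (G : FiniteGame) (i : Fin G.n) : Set (Fin (G.s i) → ℝ) :=
  {y | (∀ α, 0 ≤ y α) ∧ ∑ α, y α = 1}

/-- The product of simplices `Δ = ×ᵢ Δᵢ` of mixed strategy profiles. -/
def mixedProfiles (G : FiniteGame) : Set G.Ambient :=
  {x | ∀ i, x i ∈ G.mixedStrategies i}

/-- The total incentive `∑_β φ_{iβ}(x)` of player `i` at `x`. -/
def totalIncentive (G : FiniteGame) (φ : G.Ambient → G.Ambient) (x : G.Ambient)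
    (i : Fin G.n) : ℝ :=
  ∑ β, φ x i β

/-- Incentive functions; only the behaviour on mixed strategy profiles is constrained. -/
structure IsIncentive (G : FiniteGame) (φ : G.Ambient → G.Ambient) : Prop where
  nonneg_of_eq_zero : ∀ x ∈ G.mixedProfiles, ∀ i α, x i α = 0 → 0 ≤ φ x i α
  total_ne : ∀ x ∈ G.mixedProfiles, ∀ i, G.totalIncentive φ x i ≠ -1

/-- The revision map `T(x)ᵢ = (xᵢ + ∑_α φ_{iα}(x) e_{iα}) / (1 + ∑_β φ_{iβ}(x))`. -/
noncomputable def revisionMap (G : FiniteGame) (φ : G.Ambient → G.Ambient)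
    (x : G.Ambient) : G.Ambient :=
  fun i => (1 + G.totalIncentive φ x i)⁻¹ •
    (x i + ∑ α, φ x i α • (Pi.single α (1 : ℝ) : Fin (G.s i) → ℝ))

/-- The vector `φᵢ(x) / xᵢ` of quotients `φ_{iα}(x) / x_{iα}`, where `0 / 0 = 0`.
It is meaningful when `φ_{iα}(x) = 0` wherever `x_{iα} = 0`. -/
noncomputable def incentiveRatio (G : FiniteGame) (φ : G.Ambient → G.Ambient)
    (x : G.Ambient) (i : Fin G.n) : Fin (G.s i) → ℝ :=
  fun α => φ x i α / x i α

/-- The quotient `φᵢ(x) / xᵢ` is well defined, and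
`xᵢ · φᵢ(x)/xᵢ = max_{y ∈ K} y · φᵢ(x)/xᵢ`, the maximum being attained at `xᵢ ∈ K`. -/
def MaximizesRatioOn (G : FiniteGame) (φ : G.Ambient → G.Ambient) (x : G.Ambient)
    (i : Fin G.n) (K : Set (Fin (G.s i) → ℝ)) : Prop :=
  (∀ α, x i α = 0 → φ x i α = 0) ∧ x i ∈ K ∧
    IsGreatest ((fun y => ∑ α, y α * G.incentiveRatio φ x i α) '' K)
      (∑ α, x i α * G.incentiveRatio φ x i α)

/-- The mixed strategies of player `i` that only use pure strategies used by `xᵢ`. -/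
def supportingFace (G : FiniteGame) (x : G.Ambient) (i : Fin G.n) :
    Set (Fin (G.s i) → ℝ) :=
  {y | y ∈ G.mixedStrategies i ∧ ∀ α, x i α = 0 → y α = 0}

/-- Incentive equilibria: mixed profiles `x` at which, for every player `i`, the incentive
vanishes on unused pure strategies and `xᵢ` maximizes `y ↦ y · φᵢ(x)/xᵢ` over the mixed
strategies supported in the support of `xᵢ`.  (Over all of `Δᵢ` the convention `0 / 0 = 0` would
exclude fixed points of the revision map on the boundary with negative total incentive.) -/
def IsIncentiveEquilibrium (G : FiniteGame) (φ : G.Ambient → G.Ambient)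
    (x : G.Ambient) : Prop :=
  x ∈ G.mixedProfiles ∧ ∀ i, G.MaximizesRatioOn φ x i (G.supportingFace x i)

end FiniteGame

/-! An incentive equilibrium is a profile `x` with `φ_{iα}(x) = S_i x_{iα}` for all `i` and `α`,
where `S_i` is the total incentive of player `i`: a weighted average of the ratios `φ_{iα}(x) /
x_{iα}` with positive weights on the support of `xᵢ` is their maximum exactly when they are all
equal (`maximizesRatioOn_supportingFace_iff`). Since `1 + S_i ≠ 0`, this is also the fixed point
equation of the revision map. Over the whole simplex, pure strategies off the support contribute
the ratio `0`, so the only further condition is `0 ≤ S_i`, and it is void when `xᵢ` has full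
support.

The revision map need not send the polytope of mixed profiles to itself, so a fixed point is not
found by applying Brouwer's theorem to it. Instead one looks for a zero of the field `φᵢ(x) - S_i
xᵢ`, which has coordinate sum zero and points inward on the boundary. The map that adds its
positive part and renormalizes, as in Nash's proof, does preserve the polytope, and its fixed
points are zeros of the field (`exists_incentiveField_eq_zero`).

Brouwer's theorem is proved for a cube and transferred to the polytope by an explicit retraction.
On the cube it follows from a cubical Sperner lemma (`CubicalCochain.exists_cube_forall_ne`): if
for each direction `i` a `0`-`1` label `f i` on the grid `{0, …, N} ^ ι` is `0` on the face `vᵢ =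
0` and `1` on the face `vᵢ = N`, then some unit cube carries both values of every label. The
labels are taken as `0`-cochains modulo `2`. The cup product of their coboundaries is nonzero only
on such cubes, and by Stokes' theorem and induction on the dimension its sum over all unit cubes
is `1`. -/

/-! ### Cubical cochains modulo 2 -/

/-- Cubical cochains modulo 2 on the lattice `ι → ℕ`. The cube `(v, A)` has lowest vertex `v` and
spans one unit in each direction of `A`; cochains of all degrees are treated together. -/
abbrev CubicalCochain (ι : Type*) : Type _ := (ι → ℕ) → Finset ι → ZMod 2

namespace CubicalCochain

variable {ι : Type*} [DecidableEq ι]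

/-- The coboundary modulo 2: the sum over the upper and lower facets of a cube. -/
def coboundary (c : CubicalCochain ι) : CubicalCochain ι :=
  fun v A => ∑ a ∈ A, (c (v + Pi.single a 1) (A.erase a) + c v (A.erase a))

/-- The product of a lattice function with a cochain, the function being evaluated at the lowest
vertex of the cube. -/
def vertexMul (f : (ι → ℕ) → ZMod 2) (c : CubicalCochain ι) : CubicalCochain ι :=
  fun v A => f v * c v A

/-- The iterated cup product `δf₁ ∪ ⋯ ∪ δfₖ` of the coboundaries of the functions in the list,
encoded through `δf ∪ c = δ(f ∪ c)` for a cocycle `c`. The empty product is the constant `1` on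
vertices. -/
def cupCoboundaries : List ((ι → ℕ) → ZMod 2) → CubicalCochain ι
  | [] => fun _ A => if A = ∅ then 1 else 0
  | f :: L => coboundary (vertexMul f (cupCoboundaries L))

theorem coboundary_coboundary (c : CubicalCochain ι) (v : ι → ℕ) (A : Finset ι) :
    coboundary (coboundary c) v A = 0 := by
  have key : ∀ h : ι → ι → ZMod 2, (∀ a b, h a b = h b a) →
      ∑ a ∈ A, ∑ b ∈ A.erase a, h a b = 0 := by
    intro h hs
    rw [Finset.sum_sigma']
    refine Finset.sum_involution (fun p _ => ⟨p.2, p.1⟩) ?_ ?_ ?_ ?_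
    · rintro ⟨a, b⟩ _
      simp only
      rw [hs b a]
      exact CharTwo.add_self_eq_zero _
    · rintro ⟨a, b⟩ hp _ heq
      simp only [Finset.mem_sigma, Finset.mem_erase] at hp
      exact hp.2.1 (congrArg Sigma.fst heq)
    · rintro ⟨a, b⟩ hp
      simp only [Finset.mem_sigma, Finset.mem_erase] at hp ⊢
      exact ⟨hp.2.2, hp.2.1.symm, hp.1⟩
    · rintro ⟨a, b⟩ _
      rfl
  simp only [coboundary, ← Finset.sum_add_distrib]
  apply key (fun a b => c (v + Pi.single a 1 + Pi.single b 1) ((A.erase a).erase b)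
    + c (v + Pi.single a 1) ((A.erase a).erase b)
    + (c (v + Pi.single b 1) ((A.erase a).erase b) + c v ((A.erase a).erase b)))
  intro a b
  rw [Finset.erase_right_comm, add_right_comm v]
  ring

theorem coboundary_cupCoboundaries (L : List ((ι → ℕ) → ZMod 2)) (v : ι → ℕ) (A : Finset ι) :
    coboundary (cupCoboundaries L) v A = 0 := by
  cases L with
  | nil =>
    refine Finset.sum_eq_zero fun a _ => ?_
    simp only [cupCoboundaries]
    exact CharTwo.add_self_eq_zero _
  | cons f L => exact coboundary_coboundary _ v A

/-- The Leibniz rule, for the product of a function with a cocycle. -/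
theorem cupCoboundaries_cons (f : (ι → ℕ) → ZMod 2) (L : List ((ι → ℕ) → ZMod 2))
    (v : ι → ℕ) (A : Finset ι) :
    cupCoboundaries (f :: L) v A =
      ∑ a ∈ A, (f v + f (v + Pi.single a 1)) *
        cupCoboundaries L (v + Pi.single a 1) (A.erase a) := by
  have h : f v * coboundary (cupCoboundaries L) v A = 0 := by
    rw [coboundary_cupCoboundaries, mul_zero]
  rw [← add_zero (cupCoboundaries (f :: L) v A), ← h]
  simp only [cupCoboundaries, coboundary, vertexMul]
  rw [Finset.mul_sum, ← Finset.sum_add_distrib]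
  refine Finset.sum_congr rfl fun a _ => ?_
  linear_combination CharTwo.add_self_eq_zero (f v * cupCoboundaries L v (A.erase a))

/-- On a cube where the cup product of the `δf` does not vanish, no factor `f` is constant. -/
theorem exists_ne_of_cupCoboundaries_ne_zero (L : List ((ι → ℕ) → ZMod 2)) (v : ι → ℕ)
    (A : Finset ι) (h : cupCoboundaries L v A ≠ 0) :
    ∀ f ∈ L, ∃ p q : ι → ℕ, f p ≠ f q ∧
      (∀ i, v i ≤ p i ∧ p i ≤ v i + if i ∈ A then 1 else 0) ∧
      (∀ i, v i ≤ q i ∧ q i ≤ v i + if i ∈ A then 1 else 0) := by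
  induction L generalizing v A with
  | nil => simp
  | cons g L ih =>
    rw [cupCoboundaries_cons] at h
    obtain ⟨a, ha, hne⟩ := Finset.exists_ne_zero_of_sum_ne_zero h
    have hup : ∀ i, (v + Pi.single a 1 : ι → ℕ) i = v i + if i = a then 1 else 0 := by
      intro i
      simp [Pi.single_apply]
    intro f hf
    rcases List.mem_cons.1 hf with rfl | hf
    · refine ⟨v, v + Pi.single a 1, ?_, fun i => ⟨le_rfl, Nat.le_add_right _ _⟩, fun i => ?_⟩
      · intro heq
        apply hne
        rw [← heq, CharTwo.add_self_eq_zero, zero_mul]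
      · rw [hup]
        split_ifs <;> grind
    · obtain ⟨p, q, hpq, hp, hq⟩ := ih _ _ (right_ne_zero_of_mul hne) f hf
      refine ⟨p, q, hpq, fun i => ?_, fun i => ?_⟩
      · have := hp i
        rw [hup] at this
        grind
      · have := hq i
        rw [hup] at this
        grind

section Box

variable [Fintype ι]

/-- The lowest vertices of the unit cubes in directions `A` that tile the face of `[0, N] ^ ι`
whose coordinates outside `A` are those of `u`. -/
def box (N : ℕ) (A : Finset ι) (u : ι → ℕ) : Finset (ι → ℕ) :=
  Fintype.piFinset fun i => if i ∈ A then Finset.range N else {u i}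

theorem mem_box {N : ℕ} {A : Finset ι} {u v : ι → ℕ} :
    v ∈ box N A u ↔ ∀ i, if i ∈ A then v i < N else v i = u i := by
  simp only [box, Fintype.mem_piFinset]
  refine forall_congr' fun i => ?_
  split_ifs <;> simp

theorem sum_box_update (N : ℕ) (A : Finset ι) (u : ι → ℕ) {a : ι} (ha : a ∉ A) (k l : ℕ)
    (h : (ι → ℕ) → ZMod 2) :
    ∑ w ∈ box N A (Function.update u a k), h (Function.update w a l) =
      ∑ w ∈ box N A (Function.update u a l), h w := by
  refine Finset.sum_nbij' (fun w => Function.update w a l) (fun w => Function.update w a k)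
    ?_ ?_ ?_ ?_ (fun _ _ => rfl)
  · intro w hw
    rw [mem_box] at hw ⊢
    intro i
    have := hw i
    by_cases hi : i = a
    · subst hi; simp [ha]
    · simpa [hi] using this
  · intro w hw
    rw [mem_box] at hw ⊢
    intro i
    have := hw i
    by_cases hi : i = a
    · subst hi; simp [ha]
    · simpa [hi] using this
  · intro w hw
    have := mem_box.1 hw a
    simp only [ha, if_false, Function.update_self] at this
    simp [← this]
  · intro w hw
    have := mem_box.1 hw a
    simp only [ha, if_false, Function.update_self] at this
    simp [← this]

theorem sum_box_eq_sum_range (N : ℕ) (A : Finset ι) (u : ι → ℕ) {a : ι} (ha : a ∈ A)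
    (h : (ι → ℕ) → ZMod 2) :
    ∑ v ∈ box N A u, h v = ∑ w ∈ box N (A.erase a) (Function.update u a 0),
      ∑ k ∈ Finset.range N, h (Function.update w a k) := by
  rw [← Finset.sum_product']
  refine Finset.sum_nbij' (fun v => (Function.update v a 0, v a))
    (fun p => Function.update p.1 a p.2) ?_ ?_ ?_ ?_ ?_
  · intro v hv
    rw [mem_box] at hv
    rw [Finset.mem_product, mem_box, Finset.mem_range]
    refine ⟨fun i => ?_, by simpa [ha] using hv a⟩
    have := hv i
    by_cases hi : i = a
    · subst hi; simp
    · simpa [hi] using this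
  · intro p hp
    rw [Finset.mem_product, mem_box, Finset.mem_range] at hp
    rw [mem_box]
    intro i
    have := hp.1 i
    by_cases hi : i = a
    · subst hi; simpa [ha] using hp.2
    · simpa [hi] using this
  · intro v _
    simp
  · intro p hp
    rw [Finset.mem_product, mem_box] at hp
    have := hp.1 a
    simp only [Finset.mem_erase, ne_eq, not_true_eq_false, false_and, if_false,
      Function.update_self] at this
    ext i
    · by_cases hi : i = a
      · subst hi; simp [this]
      · simp [hi]
    · simp
  · intro v _
    simp

/-- Summing over a box the differences of `h` in one of its directions leaves the sums over the two
opposite faces. -/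
theorem sum_box_add_single (N : ℕ) (A : Finset ι) (u : ι → ℕ) {a : ι} (ha : a ∈ A)
    (h : (ι → ℕ) → ZMod 2) :
    ∑ v ∈ box N A u, (h (v + Pi.single a 1) + h v) =
      ∑ w ∈ box N (A.erase a) (Function.update u a N), h w +
        ∑ w ∈ box N (A.erase a) (Function.update u a 0), h w := by
  have hna : a ∉ A.erase a := Finset.notMem_erase a A
  rw [sum_box_eq_sum_range N A u ha, ← sum_box_update N _ u hna 0 N h,
    ← sum_box_update N _ u hna 0 0 h, ← Finset.sum_add_distrib]
  refine Finset.sum_congr rfl fun w _ => ?_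
  have hstep : ∀ k, (Function.update w a k + Pi.single a 1 : ι → ℕ) =
      Function.update w a (k + 1) := by
    intro k
    ext i
    by_cases hi : i = a
    · subst hi; simp
    · simp [hi]
  simp only [hstep]
  have := Finset.sum_range_sub (fun k => h (Function.update w a k)) N
  simpa only [CharTwo.sub_eq_add] using this

/-- Stokes' theorem modulo 2 on a box. -/
theorem sum_box_coboundary (N : ℕ) (A : Finset ι) (u : ι → ℕ) (c : CubicalCochain ι) :
    ∑ v ∈ box N A u, coboundary c v A =
      ∑ a ∈ A, (∑ w ∈ box N (A.erase a) (Function.update u a N), c w (A.erase a) +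
        ∑ w ∈ box N (A.erase a) (Function.update u a 0), c w (A.erase a)) := by
  simp only [coboundary]
  rw [Finset.sum_comm]
  exact Finset.sum_congr rfl fun a ha =>
    sum_box_add_single N A u ha fun v => c v (A.erase a)

/-- If each `f i` is `0` on the face `v i = 0` and `1` on the face `v i = N`, then the cup product
of the `δ(f i)`, over the directions of a box, evaluates to `1` on that box. -/
theorem sum_box_cupCoboundaries {N : ℕ} {f : ι → (ι → ℕ) → ZMod 2}
    (h0 : ∀ i v, v i = 0 → f i v = 0) (h1 : ∀ i v, v i = N → f i v = 1)
    (l : List ι) (hl : l.Nodup) (u : ι → ℕ) :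
    ∑ v ∈ box N l.toFinset u, cupCoboundaries (l.map f) v l.toFinset = 1 := by
  induction l generalizing u with
  | nil =>
    have : box N ∅ u = {u} := by
      ext v
      simp [mem_box, funext_iff]
    simp [cupCoboundaries, this]
  | cons a l ih =>
    obtain ⟨hal, hl⟩ := List.nodup_cons.1 hl
    have hal' : a ∉ l.toFinset := by simpa using hal
    have herase : (insert a l.toFinset).erase a = l.toFinset := Finset.erase_insert hal'
    rw [List.map_cons, List.toFinset_cons]
    simp only [cupCoboundaries]
    rw [sum_box_coboundary, Finset.sum_insert hal', herase]
    -- On the two faces orthogonal to a direction `b` of `l`, the factor `f b` is constant.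
    have hside : ∀ b ∈ l, ∀ w : ι → ℕ, (w b = 0 ∨ w b = N) →
        cupCoboundaries (l.map f) w ((insert a l.toFinset).erase b) = 0 := by
      intro b hb w hw
      by_contra hne
      obtain ⟨p, q, hpq, hp, hq⟩ :=
        exists_ne_of_cupCoboundaries_ne_zero _ _ _ hne (f b) (List.mem_map_of_mem hb)
      have hp' : p b = w b := by have := hp b; simp at this; omega
      have hq' : q b = w b := by have := hq b; simp at this; omega
      rcases hw with hw | hw
      · exact hpq (by rw [h0 b p (by omega), h0 b q (by omega)])
      · exact hpq (by rw [h1 b p (by omega), h1 b q (by omega)])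
    have hval : ∀ (b : ι) (A : Finset ι) (k : ℕ) (w : ι → ℕ), b ∉ A →
        w ∈ box N A (Function.update u b k) → w b = k := by
      intro b A k w hb hw
      simpa [hb] using mem_box.1 hw b
    rw [Finset.sum_eq_zero (s := l.toFinset), add_zero]
    · rw [Finset.sum_eq_zero (s := box N l.toFinset (Function.update u a 0)), add_zero,
        ← ih hl (Function.update u a N)]
      · refine Finset.sum_congr rfl fun w hw => ?_
        rw [vertexMul, h1 a w (hval a _ _ w hal' hw), one_mul]
      · intro w hw
        rw [vertexMul, h0 a w (hval a _ _ w hal' hw), zero_mul]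
    · intro b hb
      have hb' : b ∈ l := by simpa using hb
      have hnb : b ∉ (insert a l.toFinset).erase b := Finset.notMem_erase _ _
      rw [Finset.sum_eq_zero, Finset.sum_eq_zero, add_zero]
      · intro w hw
        rw [vertexMul, hside b hb' w (Or.inl (hval b _ _ w hnb hw)), mul_zero]
      · intro w hw
        rw [vertexMul, hside b hb' w (Or.inr (hval b _ _ w hnb hw)), mul_zero]

/-- A cubical form of Sperner's lemma: labels that separate opposite faces of a grid are all
non-constant on some common unit cube. -/
theorem exists_cube_forall_ne {N : ℕ} {f : ι → (ι → ℕ) → ZMod 2}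
    (h0 : ∀ i v, v i = 0 → f i v = 0) (h1 : ∀ i v, v i = N → f i v = 1) :
    ∃ v : ι → ℕ, (∀ i, v i < N) ∧ ∀ i, ∃ p q : ι → ℕ, f i p = 0 ∧ f i q = 1 ∧
      (∀ j, v j ≤ p j ∧ p j ≤ v j + 1) ∧ (∀ j, v j ≤ q j ∧ q j ≤ v j + 1) := by
  have hsum := sum_box_cupCoboundaries h0 h1 Finset.univ.toList (Finset.nodup_toList _) 0
  rw [Finset.toList_toFinset] at hsum
  obtain ⟨v, hv, hne⟩ := Finset.exists_ne_zero_of_sum_ne_zero (hsum ▸ one_ne_zero)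
  refine ⟨v, fun i => by simpa using mem_box.1 hv i, fun i => ?_⟩
  obtain ⟨p, q, hpq, hp, hq⟩ := exists_ne_of_cupCoboundaries_ne_zero _ _ _ hne (f i)
    (List.mem_map_of_mem (by simp))
  simp only [Finset.mem_univ, if_true] at hp hq
  have hcase : ∀ x y : ZMod 2, x ≠ y → (x = 0 ∧ y = 1) ∨ (y = 0 ∧ x = 1) := by decide
  rcases hcase _ _ hpq with h | h
  · exact ⟨p, q, h.1, h.2, hp, hq⟩
  · exact ⟨q, p, h.1, h.2, hq, hp⟩

end Box

end CubicalCochain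

/-! ### Brouwer's fixed point theorem on the unit cube -/

section Brouwer

variable {ι : Type*} [Fintype ι]

/-- The labels are the signs of the coordinates of `f x - x` at the grid points of mesh `1 / N`. -/
theorem exists_dist_le_of_continuousOn_Icc {f : (ι → ℝ) → ι → ℝ}
    (hf : ContinuousOn f (Set.Icc 0 1)) (hmaps : Set.MapsTo f (Set.Icc 0 1) (Set.Icc 0 1))
    {ε : ℝ} (hε : 0 < ε) : ∃ x ∈ Set.Icc (0 : ι → ℝ) 1, dist (f x) x ≤ ε := by
  classical
  have huc := isCompact_Icc.uniformContinuousOn_of_continuous hf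
  obtain ⟨δ, hδ, hclose⟩ := Metric.uniformContinuousOn_iff.1 huc (ε / 2) (by positivity)
  obtain ⟨N, hN⟩ := exists_nat_gt (max (1 / δ) (2 / ε))
  have hN0 : (0 : ℝ) < N := lt_of_le_of_lt (by positivity) hN
  have hNδ : 1 / (N : ℝ) < δ := by
    rw [div_lt_comm₀ hN0 hδ]
    exact (le_max_left _ _).trans_lt hN
  have hNε : 1 / (N : ℝ) < ε / 2 := by
    rw [div_lt_comm₀ hN0 (by positivity)]
    refine lt_of_eq_of_lt ?_ ((le_max_right _ _).trans_lt hN)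
    field_simp
  let pt : (ι → ℕ) → ι → ℝ := fun v i => v i / N
  have hpt : ∀ v : ι → ℕ, (∀ i, v i ≤ N) → pt v ∈ Set.Icc (0 : ι → ℝ) 1 := by
    refine fun v hv => ⟨fun i => ?_, fun i => ?_⟩
    · exact div_nonneg (Nat.cast_nonneg _) hN0.le
    · exact (div_le_one hN0).2 (by exact_mod_cast hv i)
  let lab : ι → (ι → ℕ) → ZMod 2 := fun i v =>
    if v i = 0 then 0 else if v i = N then 1 else if f (pt v) i ≤ pt v i then 1 else 0
  have hlab0 : ∀ i v, (∀ j, v j ≤ N) → lab i v = 0 → pt v i ≤ f (pt v) i := by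
    intro i v hv h
    simp only [lab] at h
    split_ifs at h with h1 h2 h3
    · simp only [pt, h1, Nat.cast_zero, zero_div]
      exact (hmaps (hpt v hv)).1 i
    · exact absurd h (by decide)
    · exact absurd h (by decide)
    · exact (not_le.1 h3).le
  have hlab1 : ∀ i v, (∀ j, v j ≤ N) → lab i v = 1 → f (pt v) i ≤ pt v i := by
    intro i v hv h
    simp only [lab] at h
    split_ifs at h with h1 h2 h3
    · exact absurd h (by decide)
    · simp only [pt, h2, div_self hN0.ne']
      exact (hmaps (hpt v hv)).2 i
    · exact h3
    · exact absurd h (by decide)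
  have hNne : N ≠ 0 := by rintro rfl; simp at hN0
  obtain ⟨v, hv, hall⟩ := CubicalCochain.exists_cube_forall_ne (N := N) (f := lab)
    (fun i v h => by simp [lab, h]) (fun i v h => by simp [lab, h, hNne])
  have hvN : ∀ i, v i ≤ N := fun i => (hv i).le
  have hnear : ∀ p : ι → ℕ, (∀ j, v j ≤ p j ∧ p j ≤ v j + 1) →
      (∀ j, p j ≤ N) ∧ (∀ j, pt v j ≤ pt p j ∧ pt p j ≤ pt v j + 1 / N) ∧
        dist (pt p) (pt v) < δ := by
    intro p hp
    have hb : ∀ j, pt v j ≤ pt p j ∧ pt p j ≤ pt v j + 1 / N := by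
      intro j
      have h1 : (v j : ℝ) ≤ p j := by exact_mod_cast (hp j).1
      have h2 : (p j : ℝ) ≤ v j + 1 := by exact_mod_cast (hp j).2
      simp only [pt]
      rw [← add_div]
      exact ⟨div_le_div_of_nonneg_right h1 hN0.le, div_le_div_of_nonneg_right h2 hN0.le⟩
    refine ⟨fun j => ?_, hb, lt_of_le_of_lt ?_ hNδ⟩
    · have := hp j
      have := hv j
      omega
    · refine (dist_pi_le_iff (by positivity)).2 fun j => ?_
      rw [Real.dist_eq, abs_le]
      have := hb j
      constructor <;> linarith
  refine ⟨pt v, hpt v hvN, (dist_pi_le_iff hε.le).2 fun i => ?_⟩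
  obtain ⟨p, q, hp0, hq1, hp, hq⟩ := hall i
  obtain ⟨hpN, hpb, hpd⟩ := hnear p hp
  obtain ⟨hqN, hqb, hqd⟩ := hnear q hq
  have e1 := hlab0 i p hpN hp0
  have e2 := hlab1 i q hqN hq1
  have d1 := (dist_le_pi_dist (f (pt p)) (f (pt v)) i).trans_lt
    (hclose _ (hpt p hpN) _ (hpt v hvN) hpd)
  have d2 := (dist_le_pi_dist (f (pt q)) (f (pt v)) i).trans_lt
    (hclose _ (hpt q hqN) _ (hpt v hvN) hqd)
  rw [Real.dist_eq, abs_lt] at d1 d2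
  rw [Real.dist_eq, abs_le]
  have := hpb i
  have := hqb i
  constructor <;> linarith

/-- Brouwer's fixed point theorem on the cube `[0, 1] ^ ι`. -/
theorem exists_fixedPoint_of_continuousOn_Icc {f : (ι → ℝ) → ι → ℝ}
    (hf : ContinuousOn f (Set.Icc 0 1)) (hmaps : Set.MapsTo f (Set.Icc 0 1) (Set.Icc 0 1)) :
    ∃ x ∈ Set.Icc (0 : ι → ℝ) 1, f x = x := by
  obtain ⟨x, hx, hmin⟩ := isCompact_Icc.exists_isMinOn
    (Set.nonempty_Icc.2 (zero_le_one : (0 : ι → ℝ) ≤ 1))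
    (continuous_dist.comp_continuousOn (hf.prodMk continuousOn_id))
  refine ⟨x, hx, dist_le_zero.1 (le_of_forall_pos_le_add fun ε hε => ?_)⟩
  obtain ⟨y, hy, hyε⟩ := exists_dist_le_of_continuousOn_Icc hf hmaps hε
  rw [zero_add]
  exact (hmin hy).trans hyε

end Brouwer

/-! ### Fixed points on the polytope of mixed strategy profiles -/

namespace FiniteGame

variable (G : FiniteGame)

/-- A retraction of the nonnegative orthant onto the polytope of mixed strategy profiles. With `t`
the coordinate sum of `z i`, it spreads the missing mass `max 1 t - t` evenly over the coordinates
of `z i` and then divides by `max 1 t`. -/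
noncomputable def profileRetraction (z : G.Ambient) : G.Ambient :=
  fun i α => (z i α + (max 1 (∑ β, z i β) - ∑ β, z i β) / G.s i) / max 1 (∑ β, z i β)

theorem continuous_profileRetraction : Continuous G.profileRetraction := by
  refine continuous_pi fun i => continuous_pi fun α => ?_
  unfold profileRetraction
  refine Continuous.div (by fun_prop) (by fun_prop) fun z => ?_
  exact (lt_of_lt_of_le one_pos (le_max_left _ _)).ne'

theorem profileRetraction_mem {z : G.Ambient} (hz : 0 ≤ z) :
    G.profileRetraction z ∈ G.mixedProfiles := by
  intro i
  have hpos : 0 < max 1 (∑ β, z i β) := lt_of_lt_of_le one_pos (le_max_left _ _)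
  have hs : (G.s i : ℝ) ≠ 0 := by exact_mod_cast (G.s_pos i).ne'
  refine ⟨fun α => ?_, ?_⟩
  · have h1 : 0 ≤ z i α := hz i α
    have h2 : 0 ≤ max 1 (∑ β, z i β) - ∑ β, z i β := sub_nonneg.2 (le_max_right _ _)
    unfold profileRetraction
    positivity
  · simp only [profileRetraction]
    rw [← Finset.sum_div, Finset.sum_add_distrib, Finset.sum_const, Finset.card_univ,
      Fintype.card_fin, nsmul_eq_mul, mul_div_cancel₀ _ hs, add_sub_cancel, div_self hpos.ne']

theorem profileRetraction_eq_self {x : G.Ambient} (hx : x ∈ G.mixedProfiles) :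
    G.profileRetraction x = x := by
  funext i α
  simp [profileRetraction, (hx i).2]

/-- Brouwer's fixed point theorem on the polytope of mixed strategy profiles, which is a retract of
the unit cube of the ambient space. -/
theorem exists_fixedPoint_of_continuousOn_mixedProfiles {f : G.Ambient → G.Ambient}
    (hf : ContinuousOn f G.mixedProfiles) (hmaps : Set.MapsTo f G.mixedProfiles G.mixedProfiles) :
    ∃ x ∈ G.mixedProfiles, f x = x := by
  let cur : ((Σ i, Fin (G.s i)) → ℝ) → G.Ambient := fun z i α => z ⟨i, α⟩
  let unc : G.Ambient → (Σ i, Fin (G.s i)) → ℝ := fun x p => x p.1 p.2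
  have hcur : Continuous cur := by fun_prop
  have hunc : Continuous unc := by fun_prop
  have hmem : ∀ z ∈ Set.Icc (0 : (Σ i, Fin (G.s i)) → ℝ) 1,
      G.profileRetraction (cur z) ∈ G.mixedProfiles := fun z hz =>
    G.profileRetraction_mem fun i α => hz.1 ⟨i, α⟩
  obtain ⟨z, hz, hfix⟩ := exists_fixedPoint_of_continuousOn_Icc
    (f := fun z => unc (f (G.profileRetraction (cur z))))
    (hunc.comp_continuousOn
      (hf.comp (G.continuous_profileRetraction.comp hcur).continuousOn hmem))
    (fun z hz => by
      have h := hmaps (hmem z hz)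
      refine ⟨fun p => (h p.1).1 p.2, fun p => ?_⟩
      rw [Pi.one_apply, ← (h p.1).2]
      exact Finset.single_le_sum (fun β _ => (h p.1).1 β) (Finset.mem_univ p.2))
  have hcz : f (G.profileRetraction (cur z)) = cur z := congrArg cur hfix
  have hcmem : cur z ∈ G.mixedProfiles := hcz ▸ hmaps (hmem z hz)
  rw [G.profileRetraction_eq_self hcmem] at hcz
  exact ⟨cur z, hcmem, hcz⟩

/-! ### Existence of incentive equilibria -/

/-- The replicator-like vector field `φᵢ(x) - (∑ β, φ_{iβ}(x)) xᵢ`, which is tangent to the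
polytope of mixed profiles and vanishes exactly at the fixed points of the revision map. -/
def incentiveField (φ : G.Ambient → G.Ambient) (x : G.Ambient) : G.Ambient :=
  fun i α => φ x i α - G.totalIncentive φ x i * x i α

variable {G} {φ : G.Ambient → G.Ambient} {x : G.Ambient}

theorem sum_incentiveField (hx : x ∈ G.mixedProfiles) (i : Fin G.n) :
    ∑ α, G.incentiveField φ x i α = 0 := by
  simp only [incentiveField, Finset.sum_sub_distrib, ← Finset.mul_sum, (hx i).2, mul_one]
  exact sub_self _

theorem continuousOn_incentiveField (hcont : ContinuousOn φ G.mixedProfiles) :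
    ContinuousOn (G.incentiveField φ) G.mixedProfiles := by
  unfold incentiveField totalIncentive
  fun_prop

/-- A zero is a fixed point of the Nash-type map that adds the positive part of the field to `x`
and renormalizes. At such a fixed point the positive part of the field is a nonnegative multiple
of `x i`; as the field sums to zero and is nonnegative off the support of `x i`, the multiple is
zero. -/
theorem exists_incentiveField_eq_zero (hφ : G.IsIncentive φ)
    (hcont : ContinuousOn φ G.mixedProfiles) :
    ∃ x ∈ G.mixedProfiles, G.incentiveField φ x = 0 := by
  have hv := continuousOn_incentiveField hcont
  let P : G.Ambient → Fin G.n → ℝ := fun x i => ∑ β, max (G.incentiveField φ x i β) 0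
  have hP : ∀ x i, 0 ≤ P x i := fun x i => Finset.sum_nonneg fun β _ => le_max_right _ _
  have hP1 : ∀ x i, 0 < 1 + P x i := fun x i => by linarith [hP x i]
  obtain ⟨x, hx, hfix⟩ := G.exists_fixedPoint_of_continuousOn_mixedProfiles
    (f := fun x i α => (x i α + max (G.incentiveField φ x i α) 0) / (1 + P x i))
    (by
      refine continuousOn_pi.2 fun i => continuousOn_pi.2 fun α => ?_
      have hvc : ∀ β, ContinuousOn (fun x => G.incentiveField φ x i β) G.mixedProfiles :=
        fun β => continuousOn_pi.1 (continuousOn_pi.1 hv i) β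
      refine ContinuousOn.div ?_ ?_ fun x _ => (hP1 x i).ne'
      · have := hvc α
        fun_prop
      · exact continuousOn_const.add
          (continuousOn_finsetSum _ fun β _ => (hvc β).sup continuousOn_const))
    (by
      refine fun x hx i => ⟨fun α => ?_, ?_⟩
      · exact div_nonneg (add_nonneg ((hx i).1 α) (le_max_right _ _)) (hP1 x i).le
      · simp only
        rw [← Finset.sum_div, Finset.sum_add_distrib, (hx i).2]
        exact div_self (hP1 x i).ne')
  refine ⟨x, hx, ?_⟩
  have hmul : ∀ i α, max (G.incentiveField φ x i α) 0 = P x i * x i α := by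
    intro i α
    have h := congrFun (congrFun hfix i) α
    rw [div_eq_iff (hP1 x i).ne'] at h
    linarith
  -- On the support of `x i` a positive multiple forces equality, off it the field is nonnegative.
  have hle : ∀ i α, P x i * x i α ≤ G.incentiveField φ x i α ∨ P x i = 0 := by
    intro i α
    rcases (hP x i).eq_or_lt with h | h
    · exact Or.inr h.symm
    refine Or.inl ?_
    rcases ((hx i).1 α).eq_or_lt with h0 | h0
    · simp only [incentiveField, ← h0, mul_zero, sub_zero]
      exact hφ.nonneg_of_eq_zero x hx i α h0.symm
    · have hpos : 0 < max (G.incentiveField φ x i α) 0 := hmul i α ▸ mul_pos h h0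
      have : 0 < G.incentiveField φ x i α := by simpa using hpos
      rw [← hmul i α, max_eq_left this.le]
  have hPzero : ∀ i, P x i = 0 := by
    intro i
    by_contra hne
    have h := Finset.sum_le_sum fun α (_ : α ∈ Finset.univ) => (hle i α).resolve_right hne
    rw [← Finset.mul_sum, (hx i).2, mul_one, sum_incentiveField hx i] at h
    exact hne (le_antisymm h (hP x i))
  have hnonpos : ∀ i α, G.incentiveField φ x i α ≤ 0 := by
    intro i α
    have h := hmul i α
    rw [hPzero i, zero_mul] at h
    exact h ▸ le_max_left _ _
  funext i α
  exact (Finset.sum_eq_zero_iff_of_nonpos fun β _ => hnonpos i β).1 (sum_incentiveField hx i) α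
    (Finset.mem_univ α)

/-! ### Equilibria and fixed points of the revision map -/

theorem revisionMap_apply (i : Fin G.n) (α : Fin (G.s i)) :
    G.revisionMap φ x i α = (1 + G.totalIncentive φ x i)⁻¹ * (x i α + φ x i α) := by
  simp [revisionMap, Finset.sum_apply, Pi.single_apply]

theorem revisionMap_eq_self_iff (hne : ∀ i, G.totalIncentive φ x i ≠ -1) :
    G.revisionMap φ x = x ↔ ∀ i α, φ x i α = G.totalIncentive φ x i * x i α := by
  simp only [funext_iff, revisionMap_apply]
  refine forall_congr' fun i => forall_congr' fun α => ?_
  have h : 1 + G.totalIncentive φ x i ≠ 0 := fun h => hne i (by linarith)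
  rw [inv_mul_eq_iff_eq_mul₀ h]
  constructor <;> intro e <;> linarith

theorem sum_mul_incentiveRatio {i : Fin G.n} (hwd : ∀ α, x i α = 0 → φ x i α = 0) :
    ∑ α, x i α * G.incentiveRatio φ x i α = G.totalIncentive φ x i := by
  refine Finset.sum_congr rfl fun α _ => ?_
  by_cases h : x i α = 0
  · rw [h, zero_mul, hwd α h]
  · exact mul_div_cancel₀ _ h

theorem single_mem_mixedStrategies (i : Fin G.n) (α : Fin (G.s i)) :
    Pi.single α 1 ∈ G.mixedStrategies i := by
  refine ⟨fun β => ?_, by simp⟩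
  rw [Pi.single_apply]
  split_ifs <;> norm_num

theorem sum_mul_le_of_mem_mixedStrategies {i : Fin G.n} {y r : Fin (G.s i) → ℝ} {c : ℝ}
    (hy : y ∈ G.mixedStrategies i) (h : ∀ α, y α ≠ 0 → r α ≤ c) : ∑ α, y α * r α ≤ c := by
  calc ∑ α, y α * r α ≤ ∑ α, y α * c := by
        refine Finset.sum_le_sum fun α _ => ?_
        by_cases h0 : y α = 0
        · simp [h0]
        · exact mul_le_mul_of_nonneg_left (h α h0) (hy.1 α)
    _ = c := by rw [← Finset.sum_mul, hy.2, one_mul]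

/-- The maximum of the ratio over the face spanned by the support of `x i` is attained at `x i`
exactly when the ratio is constant on the support; the constant is then the total incentive. -/
theorem maximizesRatioOn_supportingFace_iff (hx : x ∈ G.mixedProfiles) (i : Fin G.n) :
    G.MaximizesRatioOn φ x i (G.supportingFace x i) ↔
      ∀ α, φ x i α = G.totalIncentive φ x i * x i α := by
  constructor
  · rintro ⟨hwd, -, -, hub⟩ α
    rw [sum_mul_incentiveRatio hwd] at hub
    -- Testing against the unit vectors of the support bounds the ratio by its own average.
    have hle : ∀ β ∈ Finset.univ, φ x i β ≤ G.totalIncentive φ x i * x i β := by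
      intro β _
      by_cases h0 : x i β = 0
      · simp [h0, hwd β h0]
      · have hpos : 0 < x i β := lt_of_le_of_ne ((hx i).1 β) (Ne.symm h0)
        have hmem : (Pi.single β 1 : Fin (G.s i) → ℝ) ∈ G.supportingFace x i := by
          refine ⟨single_mem_mixedStrategies i β, fun γ hγ => Pi.single_eq_of_ne ?_ _⟩
          rintro rfl
          exact h0 hγ
        have h := hub (Set.mem_image_of_mem _ hmem)
        simp only [Pi.single_apply, ite_mul, one_mul, zero_mul, Finset.sum_ite_eq',
          Finset.mem_univ, if_true, incentiveRatio] at h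
        exact (div_le_iff₀ hpos).1 h
    refine (Finset.sum_eq_sum_iff_of_le hle).1 ?_ α (Finset.mem_univ α)
    rw [← Finset.mul_sum, (hx i).2, mul_one]
    rfl
  · intro h
    have hwd : ∀ α, x i α = 0 → φ x i α = 0 := fun α h0 => by rw [h, h0, mul_zero]
    have hmem : x i ∈ G.supportingFace x i := ⟨hx i, fun _ => id⟩
    refine ⟨hwd, hmem, ⟨x i, hmem, rfl⟩, ?_⟩
    rintro _ ⟨y, hy, rfl⟩
    rw [sum_mul_incentiveRatio hwd]
    refine sum_mul_le_of_mem_mixedStrategies hy.1 fun α hα => ?_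
    rw [incentiveRatio, h, mul_div_cancel_right₀ _ (mt (hy.2 α) hα)]

theorem isIncentiveEquilibrium_iff_revisionMap_eq_self (hφ : G.IsIncentive φ)
    (hx : x ∈ G.mixedProfiles) : G.IsIncentiveEquilibrium φ x ↔ G.revisionMap φ x = x := by
  rw [revisionMap_eq_self_iff (hφ.total_ne x hx), IsIncentiveEquilibrium, and_iff_right hx]
  exact forall_congr' fun i => maximizesRatioOn_supportingFace_iff hx i

theorem exists_isIncentiveEquilibrium (hφ : G.IsIncentive φ)
    (hcont : ContinuousOn φ G.mixedProfiles) : ∃ x, G.IsIncentiveEquilibrium φ x := by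
  obtain ⟨x, hx, hzero⟩ := exists_incentiveField_eq_zero hφ hcont
  refine ⟨x, (isIncentiveEquilibrium_iff_revisionMap_eq_self hφ hx).2 ?_⟩
  exact (revisionMap_eq_self_iff (hφ.total_ne x hx)).2 fun i α =>
    sub_eq_zero.1 (congrFun (congrFun hzero i) α)

/-- Off the support of `x i` the ratio is `0`, so passing from the supporting face to the whole
simplex only adds the comparison of `0` with the total incentive. -/
theorem maximizesRatioOn_mixedStrategies_iff (hx : x ∈ G.mixedProfiles) (i : Fin G.n) :
    G.MaximizesRatioOn φ x i (G.mixedStrategies i) ↔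
      G.MaximizesRatioOn φ x i (G.supportingFace x i) ∧
        (0 ≤ G.totalIncentive φ x i ∨ ∀ α, x i α ≠ 0) := by
  constructor
  · rintro ⟨hwd, -, -, hub⟩
    have hmem : x i ∈ G.supportingFace x i := ⟨hx i, fun _ => id⟩
    refine ⟨⟨hwd, hmem, ⟨x i, hmem, rfl⟩, fun b hb => ?_⟩, ?_⟩
    · obtain ⟨y, hy, rfl⟩ := hb
      exact hub ⟨y, hy.1, rfl⟩
    · by_contra! hcon
      obtain ⟨hneg, α, hα⟩ := hcon
      have h := hub (Set.mem_image_of_mem _ (single_mem_mixedStrategies i α))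
      rw [sum_mul_incentiveRatio hwd] at h
      simp only [Pi.single_apply, ite_mul, one_mul, zero_mul, Finset.sum_ite_eq',
        Finset.mem_univ, if_true, incentiveRatio, hα, div_zero] at h
      exact absurd h (not_le.2 hneg)
  · rintro ⟨hface, hor⟩
    have h := (maximizesRatioOn_supportingFace_iff hx i).1 hface
    refine ⟨hface.1, hx i, ⟨x i, hx i, rfl⟩, ?_⟩
    rintro _ ⟨y, hy, rfl⟩
    rw [sum_mul_incentiveRatio hface.1]
    refine sum_mul_le_of_mem_mixedStrategies hy fun α _ => ?_
    by_cases h0 : x i α = 0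
    · rw [incentiveRatio, h0, div_zero]
      exact hor.resolve_right fun hall => hall α h0
    · rw [incentiveRatio, h, mul_div_cancel_right₀ _ h0]

end FiniteGame

theorem mainTheorem1 (G : FiniteGame) (φ : G.Ambient → G.Ambient)
    (hφ : G.IsIncentive φ) (hcont : ContinuousOn φ G.mixedProfiles) :
    (∃ x, G.IsIncentiveEquilibrium φ x) ∧
    (∀ x ∈ G.mixedProfiles, G.IsIncentiveEquilibrium φ x ↔ G.revisionMap φ x = x) ∧
    (∀ x ∈ G.mixedProfiles, ∀ i,
      G.MaximizesRatioOn φ x i (G.mixedStrategies i) ↔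
        G.MaximizesRatioOn φ x i (G.supportingFace x i) ∧
          (0 ≤ G.totalIncentive φ x i ∨ ∀ α, x i α ≠ 0)) :=
  ⟨FiniteGame.exists_isIncentiveEquilibrium hφ hcont,
    fun _ hx => FiniteGame.isIncentiveEquilibrium_iff_revisionMap_eq_self hφ hx,
    fun _ hx i => FiniteGame.maximizesRatioOn_mixedStrategies_iff hx i⟩
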